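/- Let $q\ge 2$ be an integer, $[q]=\{1,\dots,q\}$, $\beta\ge 0$, $h=(h_1,\dots,h_q)\in\mathbb{R}^q$, and let $\mathcal{P}([q])$ be the set of probability vectors on $[q]$. For a real symmetric $n\times n$ matrix $A_n$, a real symmetric $q\times q$ matrix $J$ and $y\in[q]^n$ put $$H_n^{J,h}(y)=\frac12\sum_{i,j=1}^nA_n(i,j)\sum_{r,s=1}^qJ_{rs}\,\delta(y_i,r)\delta(y_j,s)+\sum_{i=1}^n\sum_{r=1}^qh_r\,\delta(y_i,r),$$ $$Z_n(J,h)=\sum_{y\in[q]^n}e^{H_n^{J,h}(y)},\qquad \Phi_n(J,h)=\log Z_n(J,h),$$ where $\delta(a,b)=1$ if $a=b$ and $0$ otherwise. A sequence $(A_n)_{n}$ of symmetric $n\times n$ real matrices is said to satisfy the mean-field assumption if, as $n\to\infty$, $$\sup_{x\in[0,1]^n}\sum_{i=1}^n\Big|\sum_{j=1}^nA_n(i,j)x_j\Big|=O(n)\qquad\text{and}\qquad \operatorname{tr}(A_n^2)=o(n).$$ Throughout let $J=\beta I_q$, and let (with $0\log 0=0$) $$\Phi^*=\sup_{p\in\mathcal{P}([q])}\Big[\frac{\beta}{2}\sum_{r=1}^qp(r)^2-\sum_{r=1}^qp(r)\log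 p(r)+\sum_{r=1}^qh_r\,p(r)\Big].$$ (a) Suppose that $(A_n)$ satisfies the mean-field assumption and that every entry of every $A_n$ is nonnegative. Let $R_n(i)=\sum_{j=1}^nA_n(i,j)$. If, as $n\to\infty$, $\frac1n\sum_{i=1}^n\delta_{R_n(i)}\to\delta_1$ weakly (here $\delta_x$ denotes the unit point mass at $x$) and $\frac1n\sum_{i=1}^nR_n(i)\to1$, then $$\lim_{n\to\infty}\frac1n\Phi_n(J,h)=\Phi^*.$$ (b) In particular, the conclusion of (a) holds in the following two cases. (i) For every $n$, $G_n=([n],E_n)$ is a $d_n$-regular simple graph, with $d_n\to\infty$, and $A_n(i,j)=\frac1{d_n}\mathbf 1\{(i,j)\in E_n\}$. Then $\frac1n\Phi_n(J,h)\to\Phi^*$. (ii) For every $n$, $G_n=([n],E_n)$ is an Erdős–Rényi random graph on $[n]$ with edge probability $p_n\in[0,1]$ (each of the $\binom n2$ possible edges is present independently with probability $p_n$), with $np_n\to\infty$, and $A_n(i,j)=\frac1{np_n}\mathbf 1\{(i,j)\in E_n\}$. Then $\frac1n\Phi_n(J,h)\to\Phi^*$ in probability, that is, for every $\varepsilon>0$,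 $\mathbb{P}\big(\big|\tfrac1n\Phi_n(J,h)-\Phi^*\big|\ge\varepsilon\big)\to0$. -/

import Mathlib

open Filter Topology MeasureTheory Asymptotics
open scoped NNReal ENNReal Matrix

namespace Potts

noncomputable section

/-- The Hamiltonian of the generalized Potts model with `q` colors on `[n]`, with interaction
matrix `A`, coupling matrix `J` and external field `h`. -/
def hamiltonian {n q : ℕ} (A : Matrix (Fin n) (Fin n) ℝ) (J : Matrix (Fin q) (Fin q) ℝ)
    (h : Fin q → ℝ) (y : Fin n → Fin q) : ℝ :=
  (1 / 2) * ∑ i, ∑ j, A i j * ∑ r, ∑ s,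
      J r s * (if y i = r then 1 else 0) * (if y j = s then 1 else 0)
    + ∑ i, ∑ r, h r * (if y i = r then 1 else 0)

/-- The partition function `Z_n(J, h)`. -/
def partitionFunction {n q : ℕ} (A : Matrix (Fin n) (Fin n) ℝ) (J : Matrix (Fin q) (Fin q) ℝ)
    (h : Fin q → ℝ) : ℝ :=
  ∑ y : Fin n → Fin q, Real.exp (hamiltonian A J h y)

/-- The log partition function `Φ_n(J, h) = log Z_n(J, h)`. -/
def logPartition {n q : ℕ} (A : Matrix (Fin n) (Fin n) ℝ) (J : Matrix (Fin q) (Fin q) ℝ)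
    (h : Fin q → ℝ) : ℝ :=
  Real.log (partitionFunction A J h)

/-- The supremum over `x ∈ [0,1]^n` of `∑ i, |∑ j, A i j * x j|`. -/
def cubeNorm {n : ℕ} (A : Matrix (Fin n) (Fin n) ℝ) : ℝ :=
  sSup ((fun x : Fin n → ℝ => ∑ i, |∑ j, A i j * x j|) '' Set.Icc 0 1)

/-- The mean-field assumption on a sequence of matrices, `A n` being of size `n × n`. -/
structure MeanFieldAssumption (A : ∀ n : ℕ, Matrix (Fin n) (Fin n) ℝ) : Prop where
  symm : ∀ n, (A n).IsSymm
  cubeNorm_isBigO : (fun n => cubeNorm (A n)) =O[atTop] fun n : ℕ => (n : ℝ)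
  trace_sq_isLittleO : (fun n => (A n * A n).trace) =o[atTop] fun n : ℕ => (n : ℝ)

/-- The row sums `R_n(i) = ∑ j, A i j`. -/
def rowSum {n : ℕ} (A : Matrix (Fin n) (Fin n) ℝ) (i : Fin n) : ℝ := ∑ j, A i j

/-- The empirical distribution `(1/n) ∑ i, δ_{x i}` (the zero measure for `n = 0`), as an element
of `FiniteMeasure ℝ`, whose topology is that of weak convergence. -/
def empiricalMeasure {n : ℕ} (x : Fin n → ℝ) : FiniteMeasure ℝ :=
  (n : ℝ≥0)⁻¹ • ∑ i, (diracProba (x i)).toFiniteMeasure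

/-- The Curie–Weiss Potts value: the supremum over probability vectors `p` on `[q]` of
`(β/2) ∑ p(r)² - ∑ p(r) log p(r) + ∑ h(r) p(r)`, where `0 log 0 = 0`. -/
def curieWeissValue {q : ℕ} (β : ℝ) (h : Fin q → ℝ) : ℝ :=
  sSup ((fun p : Fin q → ℝ =>
    β / 2 * ∑ r, p r ^ 2 - ∑ r, p r * Real.log (p r) + ∑ r, h r * p r) '' stdSimplex ℝ (Fin q))

open scoped Classical in
/-- The adjacency matrix of `G` divided by the number `c`. -/
def scaledAdjMatrix {n : ℕ} (c : ℝ) (G : SimpleGraph (Fin n)) : Matrix (Fin n) (Fin n) ℝ :=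
  Matrix.of fun i j => if G.Adj i j then 1 / c else 0

end

end Potts

/-! Both bounds come from the Gibbs variational principle. Lower bound: test it with an i.i.d.
product law `p`; the mean energy depends on `A` only through the row sums, which are close to `1` on
average (`le_logPartition`). Upper bound: cut the configurations into `exp(o(n))` classes on which
the local fields agree up to `o(n)` in `ℓ¹`. Within a class, the fields of `y` may be replaced by
those of an independent copy, so the mean energy becomes bilinear in the one-site marginals.
Subadditivity bounds the entropy by that of the marginals, and `2ab ≤ a² + b²` with `A ≥ 0` turns
the bilinear form into a sum over sites weighted by row sums. The sites are then decoupled and each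
contributes at most `Φ*` (`sum_exp_hamiltonian_le`). The classes come from sampling: keeping each
site with probability `η` and rescaling by `η⁻¹` reproduces all fields with squared error of order
`tr(A²)/η = o(n)`, and words with few non-blank letters are subexponentially many. The result is a
deterministic estimate needing only small `tr(A²)/n` and row sums close to `1` in mean. All three
cases reduce to these two inputs. -/

namespace Potts

/-! ### Gibbs variational inequality and entropy. -/

/-- The Gibbs variational inequality for a finite sum of positive weights. -/
theorem sum_mul_log_sub_le_log_sum {α : Type*} (s : Finset α) (P w : α → ℝ)
    (hP : ∀ a ∈ s, 0 ≤ P a) (hP1 : ∑ a ∈ s, P a = 1) (hw : ∀ a ∈ s, 0 < w a) :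
    ∑ a ∈ s, (P a * Real.log (w a) - P a * Real.log (P a)) ≤ Real.log (∑ a ∈ s, w a) := by
  have hs : s.Nonempty := by
    rw [Finset.nonempty_iff_ne_empty]
    rintro rfl
    simp at hP1
  have hW : 0 < ∑ a ∈ s, w a := Finset.sum_pos hw hs
  set W := ∑ a ∈ s, w a with hWdef
  -- This is `log x ≤ x - 1` at `x = w a / (W * P a)`, multiplied by `P a`; the right sides sum to
  -- `1 - 1 = 0`.
  have key : ∀ a ∈ s, P a * Real.log (w a) - P a * Real.log (P a) - P a * Real.log W
      ≤ w a / W - P a := by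
    intro a ha
    have hwa := hw a ha
    rcases (hP a ha).eq_or_lt with h0 | h0
    · rw [← h0]
      have : 0 ≤ w a / W := by positivity
      simpa using this
    · have h1 := Real.log_le_sub_one_of_pos (x := w a / (W * P a)) (by positivity)
      rw [Real.log_div hwa.ne' (by positivity), Real.log_mul hW.ne' h0.ne'] at h1
      have h2 := mul_le_mul_of_nonneg_left h1 h0.le
      have h3 : P a * (w a / (W * P a) - 1) = w a / W - P a := by field_simp
      rw [h3] at h2
      linarith
  have h := Finset.sum_le_sum key
  rw [Finset.sum_sub_distrib, Finset.sum_sub_distrib, ← Finset.sum_mul, hP1,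
    Finset.sum_sub_distrib, ← Finset.sum_div, ← hWdef, div_self hW.ne', hP1] at h
  rw [Finset.sum_sub_distrib]
  linarith

/-- Subadditivity of Shannon entropy. -/
theorem neg_sum_mul_log_le_sum_marginals {ι κ : Type*} [Fintype ι] [DecidableEq ι] [Fintype κ]
    [DecidableEq κ]
    (s : Finset (ι → κ)) (μ : (ι → κ) → ℝ) (hμ : ∀ y ∈ s, 0 < μ y) (hμ1 : ∑ y ∈ s, μ y = 1)
    (p : ι → κ → ℝ) (hp : ∀ i r, p i r = ∑ y ∈ s, μ y * if y i = r then 1 else 0) :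
    -∑ y ∈ s, μ y * Real.log (μ y) ≤ -∑ i, ∑ r, p i r * Real.log (p i r) := by
  have hp0 : ∀ i r, 0 ≤ p i r := fun i r => by
    rw [hp]
    exact Finset.sum_nonneg fun y hy => mul_nonneg (hμ y hy).le (by split_ifs <;> norm_num)
  have hp1 : ∀ i, ∑ r, p i r = 1 := fun i => by
    simp_rw [hp]
    rw [Finset.sum_comm]
    simpa using hμ1
  have hpos : ∀ y ∈ s, ∀ i, 0 < p i (y i) := fun y hy i => by
    rw [hp]
    refine Finset.sum_pos' (fun z hz => mul_nonneg (hμ z hz).le (by split_ifs <;> norm_num))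
      ⟨y, hy, by simpa using hμ y hy⟩
  -- The competing weight is the product of the marginals. Its mass on `s` is at most `1`, so the
  -- logarithm on the right is nonpositive.
  have h := sum_mul_log_sub_le_log_sum s μ (fun y => ∏ i, p i (y i)) (fun y hy => (hμ y hy).le) hμ1
    (fun y hy => Finset.prod_pos fun i _ => hpos y hy i)
  have hlog : Real.log (∑ y ∈ s, ∏ i, p i (y i)) ≤ 0 := by
    refine Real.log_nonpos (Finset.sum_nonneg fun y _ => Finset.prod_nonneg fun i _ => hp0 _ _) ?_
    calc ∑ y ∈ s, ∏ i, p i (y i) ≤ ∑ y : ι → κ, ∏ i, p i (y i) :=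
          Finset.sum_le_sum_of_subset_of_nonneg (Finset.subset_univ _)
            fun y _ _ => Finset.prod_nonneg fun i _ => hp0 _ _
      _ = ∏ i, ∑ r, p i r := by rw [Fintype.prod_sum]
      _ = 1 := by simp [hp1]
  have hsum : ∑ y ∈ s, μ y * Real.log (∏ i, p i (y i)) = ∑ i, ∑ r, p i r * Real.log (p i r) := by
    calc ∑ y ∈ s, μ y * Real.log (∏ i, p i (y i))
        = ∑ y ∈ s, ∑ i, μ y * Real.log (p i (y i)) := by
          refine Finset.sum_congr rfl fun y hy => ?_
          rw [Real.log_prod fun i _ => (hpos y hy i).ne', Finset.mul_sum]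
      _ = ∑ i, ∑ y ∈ s, μ y * Real.log (p i (y i)) := Finset.sum_comm
      _ = _ := by
          refine Finset.sum_congr rfl fun i _ => ?_
          have : ∀ r, p i r * Real.log (p i r)
              = ∑ y ∈ s, μ y * (if y i = r then 1 else 0) * Real.log (p i r) := fun r => by
            rw [← Finset.sum_mul, ← hp]
          simp_rw [this]
          rw [Finset.sum_comm]
          refine Finset.sum_congr rfl fun y _ => ?_
          simp
  rw [Finset.sum_sub_distrib, hsum] at h
  linarith

/-! ### Mean-field bound on one class of configurations. -/

theorem hamiltonian_smul_one {n q : ℕ} (A : Matrix (Fin n) (Fin n) ℝ) (β : ℝ) (h : Fin q → ℝ)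
    (y : Fin n → Fin q) :
    hamiltonian A (β • (1 : Matrix (Fin q) (Fin q) ℝ)) h y
      = β / 2 * ∑ i, ∑ j, A i j * (if y i = y j then 1 else 0) + ∑ i, h (y i) := by
  unfold hamiltonian
  congr 1
  · have : ∀ i j, ∑ r, ∑ s, (β • (1 : Matrix (Fin q) (Fin q) ℝ)) r s
        * (if y i = r then 1 else 0) * (if y j = s then 1 else 0)
        = β * (if y i = y j then 1 else 0) := by
      intro i j
      simp [Matrix.one_apply]
    simp_rw [this, Finset.mul_sum]
    refine Finset.sum_congr rfl fun i _ => Finset.sum_congr rfl fun j _ => ?_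
    ring
  · simp

theorem bddAbove_curieWeiss {q : ℕ} (β : ℝ) (h : Fin q → ℝ) :
    BddAbove ((fun p : Fin q → ℝ => β / 2 * ∑ r, p r ^ 2 - ∑ r, p r * Real.log (p r)
      + ∑ r, h r * p r) '' stdSimplex ℝ (Fin q)) := by
  refine (isCompact_stdSimplex ℝ (Fin q)).bddAbove_image (Continuous.continuousOn ?_)
  have : ∀ r : Fin q, Continuous fun p : Fin q → ℝ => p r * Real.log (p r) :=
    fun r => Real.continuous_mul_log.comp (continuous_apply r)
  have h2 : Continuous fun p : Fin q → ℝ => ∑ r, p r * Real.log (p r) :=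
    continuous_finsetSum _ fun r _ => this r
  fun_prop

/-- Apply `2ab ≤ a² + b²` entrywise, which needs nonnegative entries, and merge the two halves by
symmetry. This is what decouples the sites. -/
theorem sum_sum_mul_mul_le {ι : Type*} [Fintype ι] (A : Matrix ι ι ℝ) (hA : A.IsSymm)
    (hA0 : ∀ i j, 0 ≤ A i j) (x : ι → ℝ) :
    ∑ i, ∑ j, A i j * (x i * x j) ≤ ∑ i, (∑ j, A i j) * x i ^ 2 := by
  have h1 : ∑ i, ∑ j, A i j * (x i * x j)
      ≤ ∑ i, ∑ j, (A i j * x i ^ 2 / 2 + A i j * x j ^ 2 / 2) := by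
    refine Finset.sum_le_sum fun i _ => Finset.sum_le_sum fun j _ => ?_
    nlinarith [mul_nonneg (hA0 i j) (sq_nonneg (x i - x j))]
  have h2 : ∑ i, ∑ j, A i j * x j ^ 2 / 2 = ∑ i, ∑ j, A i j * x i ^ 2 / 2 := by
    rw [Finset.sum_comm]
    exact Finset.sum_congr rfl fun i _ => Finset.sum_congr rfl fun j _ => by rw [hA.apply]
  simp_rw [Finset.sum_add_distrib] at h1
  rw [h2] at h1
  refine h1.trans_eq ?_
  rw [← Finset.sum_add_distrib]
  refine Finset.sum_congr rfl fun i _ => ?_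
  rw [← Finset.sum_add_distrib, Finset.sum_mul]
  exact Finset.sum_congr rfl fun j _ => by ring

/-- The number `∑ j, A i j 1(y j = r)`: the field of color `r` acting on the site `i`. -/
noncomputable def localField {n q : ℕ} (A : Matrix (Fin n) (Fin n) ℝ) (y : Fin n → Fin q)
    (i : Fin n) (r : Fin q) : ℝ := ∑ j, A i j * if y j = r then 1 else 0

/-- The mean-field bound for a set of configurations whose local fields are close to each other. -/
theorem sum_exp_hamiltonian_le {n q : ℕ} (A : Matrix (Fin n) (Fin n) ℝ) (hA : A.IsSymm)
    (hA0 : ∀ i j, 0 ≤ A i j) (β : ℝ) (hβ : 0 ≤ β) (h : Fin q → ℝ) (s : Finset (Fin n → Fin q))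
    (E : ℝ)
    (hs : ∀ y ∈ s, ∀ z ∈ s, ∑ i, ∑ r, |localField A y i r - localField A z i r| ≤ E) :
    ∑ y ∈ s, Real.exp (hamiltonian A (β • (1 : Matrix (Fin q) (Fin q) ℝ)) h y)
      ≤ Real.exp (n * curieWeissValue β h + β / 2 * ∑ i, |rowSum A i - 1| + β / 2 * E) := by
  rcases s.eq_empty_or_nonempty with rfl | hne
  · simpa using Real.exp_nonneg _
  set H := hamiltonian A (β • (1 : Matrix (Fin q) (Fin q) ℝ)) h with hH
  set Z := ∑ y ∈ s, Real.exp (H y) with hZ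
  have hZ0 : 0 < Z := Finset.sum_pos (fun y _ => Real.exp_pos _) hne
  rw [← Real.log_le_iff_le_exp hZ0]
  -- For the Gibbs law conditioned on `s` the variational principle is an equality: `log Z` is mean
  -- energy plus entropy.
  set μ : (Fin n → Fin q) → ℝ := fun y => Real.exp (H y) / Z with hμ
  have hμ0 : ∀ y, 0 < μ y := fun y => div_pos (Real.exp_pos _) hZ0
  have hμ1 : ∑ y ∈ s, μ y = 1 := by
    simp_rw [hμ]
    rw [← Finset.sum_div, ← hZ, div_self hZ0.ne']
  have hlogμ : ∀ y, Real.log (μ y) = H y - Real.log Z := fun y => by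
    rw [hμ, Real.log_div (Real.exp_ne_zero _) hZ0.ne', Real.log_exp]
  have hlogZ : Real.log Z = ∑ y ∈ s, μ y * H y - ∑ y ∈ s, μ y * Real.log (μ y) := by
    simp_rw [hlogμ, mul_sub, Finset.sum_sub_distrib]
    rw [← Finset.sum_mul, hμ1]
    ring
  set p : Fin n → Fin q → ℝ := fun i r => ∑ y ∈ s, μ y * if y i = r then 1 else 0 with hp
  have hent := neg_sum_mul_log_le_sum_marginals s μ (fun y _ => hμ0 y) hμ1 p fun _ _ => rfl
  have hp0 : ∀ i r, 0 ≤ p i r := fun i r =>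
    Finset.sum_nonneg fun y _ => mul_nonneg (hμ0 y).le (by split_ifs <;> norm_num)
  have hp1 : ∀ i, ∑ r, p i r = 1 := fun i => by
    simp_rw [hp]
    rw [Finset.sum_comm]
    simpa using hμ1
  have hfield : ∑ y ∈ s, μ y * ∑ i, h (y i) = ∑ i, ∑ r, h r * p i r := by
    simp_rw [Finset.mul_sum]
    rw [Finset.sum_comm]
    refine Finset.sum_congr rfl fun i _ => ?_
    simp_rw [hp, Finset.mul_sum]
    rw [Finset.sum_comm]
    refine Finset.sum_congr rfl fun y _ => ?_
    simp [mul_comm]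
  have hquad : ∀ y z : Fin n → Fin q, ∑ i, ∑ j, A i j * (if y i = z j then 1 else 0)
      = ∑ i, localField A z i (y i) := by
    intro y z
    refine Finset.sum_congr rfl fun i _ => ?_
    simp only [localField]
    refine Finset.sum_congr rfl fun j _ => ?_
    simp only [eq_comm]
  -- Only the color `r = y i` is needed at each site, so the full `ℓ¹` distance of the fields is
  -- more than enough.
  have hpair : ∀ y ∈ s, ∀ z ∈ s, ∑ i, localField A y i (y i) ≤ ∑ i, localField A z i (y i) + E := by
    intro y hy z hz
    have h1 : ∑ i, (localField A y i (y i) - localField A z i (y i)) ≤ E := by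
      refine le_trans (Finset.sum_le_sum fun i _ => ?_) (hs y hy z hz)
      refine (le_abs_self _).trans ?_
      exact Finset.single_le_sum (f := fun r => |localField A y i r - localField A z i r|)
        (fun _ _ => abs_nonneg _) (Finset.mem_univ (y i))
    rw [Finset.sum_sub_distrib] at h1
    linarith
  -- Here `z` is an independent copy of `y`, so the joint average factors into marginals.
  have hcross : ∑ y ∈ s, ∑ z ∈ s, μ y * μ z * ∑ i, localField A z i (y i)
      = ∑ r, ∑ i, ∑ j, A i j * (p i r * p j r) := by
    have h1 : ∀ y z : Fin n → Fin q, μ y * μ z * ∑ i, localField A z i (y i)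
        = ∑ r, ∑ i, ∑ j, A i j * ((μ y * if y i = r then 1 else 0)
          * (μ z * if z j = r then 1 else 0)) := by
      intro y z
      rw [← hquad, Finset.mul_sum, Finset.sum_comm]
      refine Finset.sum_congr rfl fun i _ => ?_
      rw [Finset.mul_sum, Finset.sum_comm]
      refine Finset.sum_congr rfl fun j _ => ?_
      rw [Finset.sum_eq_single (y i)]
      · by_cases hyz : y i = z j
        · simp [hyz]; ring
        · simp [hyz, Ne.symm hyz]
      · intro r _ hr
        simp [Ne.symm hr]
      · simp
    simp_rw [h1]
    have h2 : ∀ r i j, A i j * (p i r * p j r) = ∑ y ∈ s, ∑ z ∈ s,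
        A i j * ((μ y * if y i = r then 1 else 0) * (μ z * if z j = r then 1 else 0)) := by
      intro r i j
      simp_rw [hp]
      rw [Finset.sum_mul_sum, Finset.mul_sum]
      simp_rw [Finset.mul_sum]
    simp_rw [h2]
    simp_rw [Finset.sum_comm (s := s) (t := Finset.univ)]
  have havg : ∑ y ∈ s, μ y * ∑ i, localField A y i (y i)
      ≤ ∑ r, ∑ i, ∑ j, A i j * (p i r * p j r) + E := by
    calc ∑ y ∈ s, μ y * ∑ i, localField A y i (y i)
        = ∑ y ∈ s, ∑ z ∈ s, μ y * μ z * ∑ i, localField A y i (y i) := by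
          refine Finset.sum_congr rfl fun y _ => ?_
          rw [← Finset.sum_mul, ← Finset.mul_sum, hμ1, mul_one]
      _ ≤ ∑ y ∈ s, ∑ z ∈ s, μ y * μ z * (∑ i, localField A z i (y i) + E) :=
          Finset.sum_le_sum fun y hy => Finset.sum_le_sum fun z hz =>
            mul_le_mul_of_nonneg_left (hpair y hy z hz) (mul_pos (hμ0 y) (hμ0 z)).le
      _ = _ := by
          simp_rw [mul_add, Finset.sum_add_distrib]
          rw [hcross]
          simp_rw [← Finset.sum_mul, ← Finset.mul_sum, hμ1, mul_one, hμ1, one_mul]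
  have hdiag : ∑ r, ∑ i, ∑ j, A i j * (p i r * p j r)
      ≤ ∑ i, ∑ r, p i r ^ 2 + ∑ i, |rowSum A i - 1| := by
    calc ∑ r, ∑ i, ∑ j, A i j * (p i r * p j r)
        ≤ ∑ r, ∑ i, rowSum A i * p i r ^ 2 :=
          Finset.sum_le_sum fun r _ => sum_sum_mul_mul_le A hA hA0 fun i => p i r
      _ = ∑ i, rowSum A i * ∑ r, p i r ^ 2 := by
          rw [Finset.sum_comm]
          simp_rw [Finset.mul_sum]
      _ ≤ ∑ i, (∑ r, p i r ^ 2 + |rowSum A i - 1|) := by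
          refine Finset.sum_le_sum fun i _ => ?_
          have h0 : 0 ≤ ∑ r, p i r ^ 2 := Finset.sum_nonneg fun r _ => sq_nonneg _
          have h1 : ∑ r, p i r ^ 2 ≤ 1 := by
            rw [← hp1 i]
            refine Finset.sum_le_sum fun r _ => ?_
            have : p i r ≤ 1 := by
              rw [← hp1 i]
              exact Finset.single_le_sum (f := p i) (fun r _ => hp0 i r) (Finset.mem_univ r)
            nlinarith [hp0 i r]
          have h2 : (rowSum A i - 1) * ∑ r, p i r ^ 2 ≤ |rowSum A i - 1| * 1 :=
            mul_le_mul (le_abs_self _) h1 h0 (abs_nonneg _)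
          linarith
      _ = _ := Finset.sum_add_distrib
  have hsup : ∀ i, β / 2 * ∑ r, p i r ^ 2 - ∑ r, p i r * Real.log (p i r) + ∑ r, h r * p i r
      ≤ curieWeissValue β h := fun i =>
    le_csSup (bddAbove_curieWeiss β h) ⟨p i, ⟨hp0 i, hp1 i⟩, rfl⟩
  have hsupn := Finset.sum_le_sum fun i (_ : i ∈ (Finset.univ : Finset (Fin n))) => hsup i
  simp_rw [Finset.sum_add_distrib, Finset.sum_sub_distrib] at hsupn
  rw [← Finset.mul_sum] at hsupn
  simp only [Finset.sum_const, Finset.card_univ, Fintype.card_fin, nsmul_eq_mul] at hsupn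
  have hHsum : ∑ y ∈ s, μ y * H y
      = β / 2 * ∑ y ∈ s, μ y * ∑ i, localField A y i (y i) + ∑ i, ∑ r, h r * p i r := by
    rw [← hfield, Finset.mul_sum, ← Finset.sum_add_distrib]
    refine Finset.sum_congr rfl fun y _ => ?_
    rw [hH, hamiltonian_smul_one, hquad]
    ring
  have hmul := mul_le_mul_of_nonneg_left (havg.trans (add_le_add_left hdiag E))
    (div_nonneg hβ zero_le_two)
  rw [hlogZ, hHsum]
  linarith

/-! ### Sparse approximation of local fields. -/

/-- A sum of vectors is approximated by the rescaled sum over a sparse subset of the indices. -/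
theorem exists_subset_norm_sq_add_card_le {ι F : Type*} [NormedAddCommGroup F]
    [InnerProductSpace ℝ F] (s : Finset ι) (u : ι → F) {η : ℝ} (hη0 : 0 < η)
    (hη1 : η ≤ 1) (c : ℝ) (w : F) :
    ∃ S ⊆ s, ‖w + η⁻¹ • ∑ j ∈ S, u j - ∑ j ∈ s, u j‖ ^ 2 + c * (S.card : ℝ)
      ≤ ‖w‖ ^ 2 + ∑ j ∈ s, (η⁻¹ * ‖u j‖ ^ 2 + c * η) := by
  classical
  induction s using Finset.induction_on generalizing w with
  | empty => exact ⟨∅, subset_rfl, by simp⟩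
  | insert a s ha ih =>
    -- Conditional expectations replace random sampling; `w` is the error accumulated so far.
    -- Keeping `a` adds `(η⁻¹ - 1) • u a`, dropping it adds `-u a`. With weights `η` and `1 - η`
    -- these average to zero, so the cross terms cancel in `havg`, and the better branch is at most
    -- the average.
    obtain ⟨S, hS, h1⟩ := ih (w + (η⁻¹ - 1) • u a)
    obtain ⟨T, hT, h2⟩ := ih (w - u a)
    have haS : a ∉ S := fun h => ha (hS h)
    have e1 : ‖w + (η⁻¹ - 1) • u a‖ ^ 2
        = ‖w‖ ^ 2 + 2 * (η⁻¹ - 1) * inner ℝ w (u a) + (η⁻¹ - 1) ^ 2 * ‖u a‖ ^ 2 := by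
      rw [norm_add_sq_real, inner_smul_right, norm_smul, mul_pow, Real.norm_eq_abs, sq_abs]
      ring
    have e2 : ‖w - u a‖ ^ 2 = ‖w‖ ^ 2 - 2 * inner ℝ w (u a) + ‖u a‖ ^ 2 := norm_sub_sq_real _ _
    have havg : η * (‖w + (η⁻¹ - 1) • u a‖ ^ 2 + c) + (1 - η) * ‖w - u a‖ ^ 2
        ≤ ‖w‖ ^ 2 + (η⁻¹ * ‖u a‖ ^ 2 + c * η) := by
      rw [e1, e2]
      have hη : η * η⁻¹ = 1 := mul_inv_cancel₀ hη0.ne'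
      have : η * (‖w‖ ^ 2 + 2 * (η⁻¹ - 1) * inner ℝ w (u a) + (η⁻¹ - 1) ^ 2 * ‖u a‖ ^ 2 + c)
          + (1 - η) * (‖w‖ ^ 2 - 2 * inner ℝ w (u a) + ‖u a‖ ^ 2)
          = ‖w‖ ^ 2 + (η⁻¹ * ‖u a‖ ^ 2 + c * η) - ‖u a‖ ^ 2 := by
        have h3 : η * (η⁻¹ - 1) ^ 2 = η⁻¹ - 2 + η := by linear_combination (η⁻¹ - 2) * hη
        linear_combination ‖u a‖ ^ 2 * h3 + 2 * inner ℝ w (u a) * hη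
      nlinarith [sq_nonneg ‖u a‖]
    rw [Finset.sum_insert ha, Finset.sum_insert ha]
    set B := ∑ j ∈ s, (η⁻¹ * ‖u j‖ ^ 2 + c * η)
    rcases le_total (‖w + (η⁻¹ - 1) • u a‖ ^ 2 + c) (‖w - u a‖ ^ 2) with h | h
    · refine ⟨insert a S, Finset.insert_subset_insert a hS, ?_⟩
      rw [Finset.sum_insert haS, Finset.card_insert_of_notMem haS]
      have e3 : w + η⁻¹ • (u a + ∑ j ∈ S, u j) - (u a + ∑ j ∈ s, u j)
          = w + (η⁻¹ - 1) • u a + η⁻¹ • ∑ j ∈ S, u j - ∑ j ∈ s, u j := by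
        module
      rw [e3]
      push_cast
      nlinarith
    · refine ⟨T, hT.trans (Finset.subset_insert a s), ?_⟩
      have e3 : w + η⁻¹ • ∑ j ∈ T, u j - (u a + ∑ j ∈ s, u j)
          = w - u a + η⁻¹ • ∑ j ∈ T, u j - ∑ j ∈ s, u j := by
        module
      rw [e3]
      nlinarith

theorem trace_mul_self_eq_sum_sq {n : ℕ} (A : Matrix (Fin n) (Fin n) ℝ) (hA : A.IsSymm) :
    (A * A).trace = ∑ j, ∑ i, A i j ^ 2 := by
  simp only [Matrix.trace, Matrix.diag_apply, Matrix.mul_apply]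
  refine Finset.sum_congr rfl fun j _ => Finset.sum_congr rfl fun i _ => ?_
  rw [hA.apply, sq]

/-- The local fields of a configuration are approximated by those of a sparse restriction. -/
theorem exists_sparse_localField {n q : ℕ} (A : Matrix (Fin n) (Fin n) ℝ) (hA : A.IsSymm)
    {κ η : ℝ} (hκ : 0 < κ) (hη0 : 0 < η) (hη1 : η ≤ 1) (htr : (A * A).trace ≤ κ * n)
    (y : Fin n → Fin q) :
    ∃ z : Fin n → Option (Fin q), ((Finset.univ.filter fun j => z j ≠ none).card : ℝ) ≤ 2 * η * n ∧
      ∑ i, ∑ r, |localField A y i r - η⁻¹ * ∑ j, A i j * if z j = some r then 1 else 0|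
        ≤ n * Real.sqrt (2 * q * κ / η) := by
  classical
  let u : Fin n → EuclideanSpace ℝ (Fin n × Fin q) :=
    fun j => WithLp.toLp 2 fun x => A x.1 j * if y j = x.2 then 1 else 0
  have hu : ∀ j, ‖u j‖ ^ 2 = ∑ i, A i j ^ 2 := fun j => by
    rw [EuclideanSpace.norm_sq_eq, Fintype.sum_prod_type]
    refine Finset.sum_congr rfl fun i _ => ?_
    simp [u]
  -- The penalty `κ / η ^ 2` gives error and cardinality the same budget `κ n / η`. Either term
  -- alone is then at most twice that, whence `#S ≤ 2ηn`.
  obtain ⟨S, -, hS⟩ := exists_subset_norm_sq_add_card_le Finset.univ u hη0 hη1 (κ / η ^ 2) 0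
  have hsum : ∑ j, (η⁻¹ * ‖u j‖ ^ 2 + κ / η ^ 2 * η) ≤ 2 * κ * n / η := by
    rw [Finset.sum_add_distrib, ← Finset.mul_sum]
    simp_rw [hu]
    rw [← trace_mul_self_eq_sum_sq A hA]
    simp only [Finset.sum_const, Finset.card_univ, Fintype.card_fin, nsmul_eq_mul]
    calc η⁻¹ * (A * A).trace + n * (κ / η ^ 2 * η) ≤ η⁻¹ * (κ * n) + n * (κ / η ^ 2 * η) := by
          gcongr
      _ = 2 * κ * n / η := by field_simp; ring
  rw [norm_zero, zero_pow two_ne_zero, zero_add, zero_add] at hS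
  replace hS := hS.trans hsum
  refine ⟨fun j => if j ∈ S then some (y j) else none, ?_, ?_⟩
  · have h1 : (Finset.univ.filter fun j => (if j ∈ S then some (y j) else none) ≠ none) = S := by
      ext j
      simp
    rw [h1]
    have h2 : κ / η ^ 2 * (S.card : ℝ) ≤ 2 * κ * n / η := le_trans (by simp) hS
    have h3 : 2 * κ * n / η = κ / η ^ 2 * (2 * η * n) := by field_simp
    rw [h3] at h2
    exact le_of_mul_le_mul_left h2 (by positivity)
  · have h2 : ‖η⁻¹ • ∑ j ∈ S, u j - ∑ j, u j‖ ^ 2 ≤ 2 * κ * n / η :=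
      le_trans (le_add_of_nonneg_right (by positivity)) hS
    rw [EuclideanSpace.norm_sq_eq] at h2
    have hcoord : ∀ i r, |(η⁻¹ • ∑ j ∈ S, u j - ∑ j, u j) (i, r)|
        = |localField A y i r
          - η⁻¹ * ∑ j, A i j * if (if j ∈ S then some (y j) else none) = some r then 1 else 0| := by
      intro i r
      rw [abs_sub_comm]
      congr 1
      have h3 : ∑ j, A i j * (if (if j ∈ S then some (y j) else none) = some r then (1 : ℝ) else 0)
          = ∑ j ∈ S, A i j * if y j = r then 1 else 0 := by
        rw [← Finset.sum_filter_add_sum_filter_not Finset.univ (· ∈ S)]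
        rw [Finset.sum_eq_zero (s := Finset.univ.filter fun x => x ∉ S), add_zero,
          Finset.filter_univ_mem]
        · exact Finset.sum_congr rfl fun j hj => by simp [hj]
        · intro j hj
          simp only [Finset.mem_filter, Finset.mem_univ, true_and] at hj
          simp [hj]
      rw [h3]
      simp [u, localField]
    simp_rw [← hcoord]
    rw [← Fintype.sum_prod_type' (f := fun i r => |(η⁻¹ • ∑ j ∈ S, u j - ∑ j, u j) (i, r)|)]
    have hn : (0 : ℝ) ≤ n := Nat.cast_nonneg n
    -- Cauchy–Schwarz over the `n q` coordinates passes from `ℓ²` to `ℓ¹`.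
    have hcs := sq_sum_le_card_mul_sum_sq (s := (Finset.univ : Finset (Fin n × Fin q)))
      (f := fun x => |(η⁻¹ • ∑ j ∈ S, u j - ∑ j, u j) x|)
    simp only [Finset.card_univ, Fintype.card_prod, Fintype.card_fin] at hcs
    refine abs_le_of_sq_le_sq' (a := ∑ x, |(η⁻¹ • ∑ j ∈ S, u j - ∑ j, u j) x|) ?_
      (by positivity) |>.2
    refine hcs.trans ?_
    rw [mul_pow, Real.sq_sqrt (by positivity)]
    simp only [Real.norm_eq_abs] at h2
    calc _ ≤ ((n * q : ℕ) : ℝ) * (2 * κ * n / η) := mul_le_mul_of_nonneg_left h2 (by positivity)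
      _ = _ := by push_cast; ring

/-- The number of sparse words is subexponential. -/
theorem card_sparse_mul_rpow_le {n q : ℕ} {t m : ℝ} (ht0 : 0 < t) (ht1 : t ≤ 1) :
    ((Finset.univ.filter fun z : Fin n → Option (Fin q) =>
      ((Finset.univ.filter fun j => z j ≠ none).card : ℝ) ≤ m).card : ℝ) * t ^ m
      ≤ (1 + q * t) ^ n := by
  -- Exponential Markov bound: a word weighs `t` to its number of non-blank letters, the total
  -- weight is `(1 + q t) ^ n`, and a sparse word weighs at least `t ^ m` since `t ≤ 1`.
  have h1 : ∑ z : Fin n → Option (Fin q), ∏ j, (if z j ≠ none then t else 1) = (1 + q * t) ^ n := by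
    rw [← Fintype.prod_sum (f := fun (_ : Fin n) (o : Option (Fin q)) => if o ≠ none then t else 1)]
    simp [Fintype.sum_option]
  rw [← h1, ← nsmul_eq_mul, ← Finset.sum_const]
  refine le_trans (Finset.sum_le_sum fun z hz => ?_) (Finset.sum_le_sum_of_subset_of_nonneg
    (Finset.subset_univ _) fun z _ _ => Finset.prod_nonneg fun j _ => ?_)
  · rw [Finset.mem_filter] at hz
    rw [Finset.prod_ite, Finset.prod_const, Finset.prod_const_one, mul_one, ← Real.rpow_natCast]
    exact Real.rpow_le_rpow_of_exponent_ge ht0 ht1 hz.2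
  · split_ifs <;> positivity

/-! ### Upper and lower bounds on the log partition function. -/

theorem partitionFunction_pos {n q : ℕ} (hq : 0 < q) (A : Matrix (Fin n) (Fin n) ℝ)
    (J : Matrix (Fin q) (Fin q) ℝ) (h : Fin q → ℝ) : 0 < partitionFunction A J h := by
  have : NeZero q := ⟨hq.ne'⟩
  exact Finset.sum_pos (fun _ _ => Real.exp_pos _) Finset.univ_nonempty

/-- The classes are the fibers of the sparse code. Their number costs `q t - 2 η log t` per site;
two members of a fiber lie within twice the approximation error, which gives the square root. -/
theorem logPartition_le {n q : ℕ} (hq : 0 < q) (A : Matrix (Fin n) (Fin n) ℝ) (hA : A.IsSymm)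
    (hA0 : ∀ i j, 0 ≤ A i j) {β : ℝ} (hβ : 0 ≤ β) (h : Fin q → ℝ)
    {κ η t : ℝ} (hκ : 0 < κ) (hη0 : 0 < η) (hη1 : η ≤ 1) (ht0 : 0 < t) (ht1 : t ≤ 1)
    (htr : (A * A).trace ≤ κ * n) :
    logPartition A (β • (1 : Matrix (Fin q) (Fin q) ℝ)) h
      ≤ n * (curieWeissValue β h + q * t - 2 * η * Real.log t + β * Real.sqrt (2 * q * κ / η))
        + β / 2 * ∑ i, |rowSum A i - 1| := by
  classical
  choose code hsparse hclose using
    fun y : Fin n → Fin q => exists_sparse_localField A hA hκ hη0 hη1 htr y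
  set W := Finset.univ.filter fun z : Fin n → Option (Fin q) =>
      ((Finset.univ.filter fun j => z j ≠ none).card : ℝ) ≤ 2 * η * n with hW
  set B := n * curieWeissValue β h + β / 2 * ∑ i, |rowSum A i - 1|
    + β / 2 * (2 * (n * Real.sqrt (2 * q * κ / η))) with hB
  have hZ : partitionFunction A (β • (1 : Matrix (Fin q) (Fin q) ℝ)) h ≤ W.card * Real.exp B := by
    rw [partitionFunction, ← Finset.sum_fiberwise_of_maps_to (s := Finset.univ) (t := W) (g := code)
      (fun y _ => by rw [hW, Finset.mem_filter]; exact ⟨Finset.mem_univ _, hsparse y⟩),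
      ← nsmul_eq_mul]
    refine Finset.sum_le_card_nsmul _ _ _ fun z _ => ?_
    refine sum_exp_hamiltonian_le A hA hA0 β hβ h _ _ fun y hy y' hy' => ?_
    rw [Finset.mem_filter] at hy hy'
    have h1 := hclose y
    have h2 := hclose y'
    rw [hy.2] at h1
    rw [hy'.2] at h2
    rw [two_mul]
    refine le_trans ?_ (add_le_add h1 h2)
    simp_rw [← Finset.sum_add_distrib]
    refine Finset.sum_le_sum fun i _ => Finset.sum_le_sum fun r _ => ?_
    rw [abs_sub_comm (localField A y' i r)]
    exact abs_sub_le _ _ _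
  have hZ0 := partitionFunction_pos hq A (β • (1 : Matrix (Fin q) (Fin q) ℝ)) h
  have hW0 : (0 : ℝ) < W.card := by
    rcases (Nat.cast_nonneg (α := ℝ) W.card).eq_or_lt with h0 | h0
    · rw [← h0, zero_mul] at hZ
      exact absurd hZ0 hZ.not_gt
    · exact h0
  have hlogZ := Real.log_le_log hZ0 hZ
  rw [Real.log_mul hW0.ne' (Real.exp_ne_zero _), Real.log_exp] at hlogZ
  have hcount := Real.log_le_log (by positivity)
    (card_sparse_mul_rpow_le (n := n) (q := q) (m := 2 * η * n) ht0 ht1)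
  rw [← hW, Real.log_mul hW0.ne' (by positivity), Real.log_rpow ht0, Real.log_pow] at hcount
  have hlog1 : Real.log (1 + q * t) ≤ q * t := by
    have := Real.log_le_sub_one_of_pos (x := 1 + q * t) (by positivity)
    linarith
  have hlogn := mul_le_mul_of_nonneg_left hlog1 (Nat.cast_nonneg (α := ℝ) n)
  rw [logPartition]
  rw [hB] at hlogZ
  linarith

/-- Absorbing the observable into the factor of its own site keeps a product over sites, whose other
factors sum to `1`. -/
theorem sum_prod_mul_apply {ι κ : Type*} [Fintype ι] [DecidableEq ι] [Fintype κ] (p : κ → ℝ)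
    (hp : ∑ r, p r = 1) (a : κ → ℝ) (i : ι) :
    ∑ y : ι → κ, (∏ k, p (y k)) * a (y i) = ∑ r, p r * a r := by
  have h1 : ∀ y : ι → κ, (∏ k, p (y k)) * a (y i)
      = ∏ k, (p (y k) * if k = i then a (y k) else 1) := fun y => by
    rw [Finset.prod_mul_distrib]
    simp
  simp_rw [h1]
  rw [← Fintype.prod_sum (f := fun (k : ι) r => p r * if k = i then a r else 1)]
  rw [Finset.prod_eq_single i]
  · simp
  · intro k _ hk
    simpa [hk] using hp
  · simp

theorem sum_prod_mul_apply_mul_apply {ι κ : Type*} [Fintype ι] [DecidableEq ι] [Fintype κ]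
    (p : κ → ℝ) (hp : ∑ r, p r = 1) (a b : κ → ℝ) {i j : ι} (hij : i ≠ j) :
    ∑ y : ι → κ, (∏ k, p (y k)) * (a (y i) * b (y j)) = (∑ r, p r * a r) * ∑ r, p r * b r := by
  have h1 : ∀ y : ι → κ, (∏ k, p (y k)) * (a (y i) * b (y j))
      = ∏ k, (p (y k) * ((if k = i then a (y k) else 1) * if k = j then b (y k) else 1)) :=
    fun y => by
      rw [Finset.prod_mul_distrib, Finset.prod_mul_distrib]
      simp
  simp_rw [h1]
  rw [← Fintype.prod_sum (f := fun (k : ι) r =>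
    p r * ((if k = i then a r else 1) * if k = j then b r else 1))]
  have h2 : ∀ k : ι, ∑ r, p r * ((if k = i then a r else 1) * if k = j then b r else 1)
      = (if k = i then ∑ r, p r * a r else 1) * if k = j then ∑ r, p r * b r else 1 := by
    intro k
    by_cases hi : k = i
    · have hj : k ≠ j := fun hj => hij (hi.symm.trans hj)
      simp [hi, hij]
    · by_cases hj : k = j
      · simp [hj, hij.symm]
      · simpa [hi, hj] using hp
  simp_rw [h2]
  rw [Finset.prod_mul_distrib]
  simp

/-- The lower bound on the log partition function given by product measures. -/
theorem le_logPartition {n q : ℕ} (A : Matrix (Fin n) (Fin n) ℝ) (hA0 : ∀ i j, 0 ≤ A i j)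
    {β : ℝ} (hβ : 0 ≤ β) (h : Fin q → ℝ) (p : Fin q → ℝ) (hp : p ∈ stdSimplex ℝ (Fin q)) :
    β / 2 * (∑ i, rowSum A i) * ∑ r, p r ^ 2
        + n * (∑ r, h r * p r - ∑ r, p r * Real.log (p r))
      ≤ logPartition A (β • (1 : Matrix (Fin q) (Fin q) ℝ)) h := by
  classical
  obtain ⟨hp0, hp1⟩ := hp
  set H := hamiltonian A (β • (1 : Matrix (Fin q) (Fin q) ℝ)) h with hH
  set P : (Fin n → Fin q) → ℝ := fun y => ∏ k, p (y k) with hP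
  have hP0 : ∀ y, 0 ≤ P y := fun y => Finset.prod_nonneg fun k _ => hp0 _
  have hP1 : ∑ y, P y = 1 := by
    rw [hP, ← Fintype.prod_sum (f := fun (_ : Fin n) r => p r)]
    simp [hp1]
  have hgibbs := sum_mul_log_sub_le_log_sum Finset.univ P (fun y => Real.exp (H y))
    (fun y _ => hP0 y) hP1 fun y _ => Real.exp_pos _
  simp only [Real.log_exp, Finset.sum_sub_distrib] at hgibbs
  have hent : ∑ y, P y * Real.log (P y) = n * ∑ r, p r * Real.log (p r) := by
    have h1 : ∀ y, P y * Real.log (P y) = ∑ i, P y * Real.log (p (y i)) := fun y => by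
      rcases eq_or_ne (P y) 0 with h0 | h0
      · simp [h0]
      · rw [← Finset.mul_sum, ← Real.log_prod]
        intro i hi h00
        exact h0 (Finset.prod_eq_zero hi h00)
    simp_rw [h1]
    rw [Finset.sum_comm]
    simp_rw [hP, sum_prod_mul_apply p hp1 (fun r => Real.log (p r))]
    simp
  have hext : ∑ y, P y * ∑ i, h (y i) = n * ∑ r, h r * p r := by
    simp_rw [Finset.mul_sum]
    rw [Finset.sum_comm]
    simp_rw [hP, sum_prod_mul_apply p hp1 h]
    simp [mul_comm, Finset.mul_sum]
  -- Equality holds off the diagonal. On it the right side is `1`, so diagonal entries of `A` only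
  -- help.
  have hpair : ∀ i j, ∑ r, p r ^ 2 ≤ ∑ y, P y * if y i = y j then 1 else 0 := by
    intro i j
    rcases eq_or_ne i j with rfl | hij
    · simp only [if_true, mul_one, hP1]
      rw [← hp1]
      refine Finset.sum_le_sum fun r _ => ?_
      have : p r ≤ 1 := by
        rw [← hp1]
        exact Finset.single_le_sum (fun r _ => hp0 r) (Finset.mem_univ r)
      nlinarith [hp0 r]
    · have h1 : ∀ y : Fin n → Fin q, (P y * if y i = y j then 1 else 0)
          = ∑ r, P y * ((if y i = r then 1 else 0) * if y j = r then 1 else 0) := fun y => by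
        rw [← Finset.mul_sum]
        simp [eq_comm]
      simp_rw [h1]
      rw [Finset.sum_comm]
      refine Finset.sum_le_sum fun r _ => ?_
      rw [hP, sum_prod_mul_apply_mul_apply p hp1 (fun x => if x = r then 1 else 0)
        (fun x => if x = r then 1 else 0) hij]
      simp [sq]
  have hint : (∑ i, rowSum A i) * ∑ r, p r ^ 2
      ≤ ∑ y, P y * ∑ i, ∑ j, A i j * if y i = y j then 1 else 0 := by
    have h1 : ∑ y, P y * ∑ i, ∑ j, A i j * (if y i = y j then 1 else 0)
        = ∑ i, ∑ j, A i j * ∑ y, P y * if y i = y j then 1 else 0 := by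
      simp_rw [Finset.mul_sum]
      rw [Finset.sum_comm]
      refine Finset.sum_congr rfl fun i _ => ?_
      rw [Finset.sum_comm]
      exact Finset.sum_congr rfl fun j _ => Finset.sum_congr rfl fun y _ => by ring
    rw [h1]
    simp_rw [rowSum, Finset.sum_mul]
    exact Finset.sum_le_sum fun i _ => Finset.sum_le_sum fun j _ =>
      mul_le_mul_of_nonneg_left (hpair i j) (hA0 i j)
  have hHsum : ∑ y, P y * H y = β / 2 * ∑ y, P y * ∑ i, ∑ j, A i j * (if y i = y j then 1 else 0)
      + ∑ y, P y * ∑ i, h (y i) := by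
    rw [Finset.mul_sum, ← Finset.sum_add_distrib]
    refine Finset.sum_congr rfl fun y _ => ?_
    rw [hH, hamiltonian_smul_one]
    ring
  rw [hHsum, hent, hext] at hgibbs
  have := mul_le_mul_of_nonneg_left hint (div_nonneg hβ zero_le_two)
  rw [logPartition, partitionFunction]
  linarith

theorem curieWeissValue_le {n q : ℕ} (hq : 0 < q) (A : Matrix (Fin n) (Fin n) ℝ)
    (hA0 : ∀ i j, 0 ≤ A i j) {β : ℝ} (hβ : 0 ≤ β) (h : Fin q → ℝ) :
    n * curieWeissValue β h ≤ logPartition A (β • (1 : Matrix (Fin q) (Fin q) ℝ)) h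
      + β / 2 * ∑ i, |rowSum A i - 1| := by
  rcases Nat.eq_zero_or_pos n with rfl | hn
  · obtain ⟨p, hp⟩ : (stdSimplex ℝ (Fin q)).Nonempty := ⟨_, single_mem_stdSimplex ℝ ⟨0, hq⟩⟩
    have := le_logPartition A hA0 hβ h p hp
    simpa using this
  have hn' : (0 : ℝ) < n := Nat.cast_pos.2 hn
  rw [mul_comm, ← le_div_iff₀ hn']
  refine csSup_le (Set.Nonempty.image _ ⟨_, single_mem_stdSimplex ℝ ⟨0, hq⟩⟩) ?_
  rintro _ ⟨p, hp, rfl⟩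
  rw [le_div_iff₀ hn']
  have hlow := le_logPartition A hA0 hβ h p hp
  have h0 : 0 ≤ ∑ r, p r ^ 2 := Finset.sum_nonneg fun r _ => sq_nonneg _
  have h1 : ∑ r, p r ^ 2 ≤ 1 := by
    rw [← hp.2]
    refine Finset.sum_le_sum fun r _ => ?_
    have : p r ≤ 1 := by
      rw [← hp.2]
      exact Finset.single_le_sum (fun r _ => hp.1 r) (Finset.mem_univ r)
    nlinarith [hp.1 r]
  have h2 : (n - ∑ i, rowSum A i) * ∑ r, p r ^ 2 ≤ ∑ i, |rowSum A i - 1| := by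
    have h3 : (n : ℝ) - ∑ i, rowSum A i ≤ ∑ i, |rowSum A i - 1| := by
      have : (n : ℝ) - ∑ i, rowSum A i = ∑ i, (1 - rowSum A i) := by simp
      rw [this]
      refine Finset.sum_le_sum fun i _ => ?_
      rw [abs_sub_comm]
      exact le_abs_self _
    have h4 : 0 ≤ ∑ i, |rowSum A i - 1| := Finset.sum_nonneg fun i _ => abs_nonneg _
    nlinarith
  have := mul_le_mul_of_nonneg_left h2 (div_nonneg hβ zero_le_two)
  simp only
  linarith

/-- Universality of the Curie–Weiss value, for a matrix of small Frobenius norm that is close to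
having all row sums equal to `1`. -/
theorem exists_abs_logPartition_sub_lt {q : ℕ} (hq : 0 < q) {β : ℝ} (hβ : 0 ≤ β) (h : Fin q → ℝ)
    {ε : ℝ} (hε : 0 < ε) :
    ∃ κ > 0, ∀ n : ℕ, 0 < n → ∀ A : Matrix (Fin n) (Fin n) ℝ, A.IsSymm → (∀ i j, 0 ≤ A i j) →
      (A * A).trace ≤ κ * n → ∑ i, |rowSum A i - 1| ≤ κ * n →
      |(1 / (n : ℝ)) * logPartition A (β • (1 : Matrix (Fin q) (Fin q) ℝ)) h
        - curieWeissValue β h| < ε := by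
  -- The order matters: `η` must be small against the fixed `log t`, then `κ` small against the
  -- fixed `η`.
  obtain ⟨t, ht0, ht1, ht⟩ : ∃ t : ℝ, 0 < t ∧ t ≤ 1 ∧ q * t < ε / 4 := by
    have hc : Tendsto (fun t : ℝ => (q : ℝ) * t) (𝓝[>] 0) (𝓝 (q * 0)) :=
      ((continuous_const.mul continuous_id).tendsto _).mono_left nhdsWithin_le_nhds
    rw [mul_zero] at hc
    obtain ⟨t, h1, h2⟩ := ((hc.eventually_lt_const (by positivity : (0 : ℝ) < ε / 4)).and
      (Ioc_mem_nhdsGT one_pos)).exists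
    exact ⟨t, h2.1, h2.2, h1⟩
  obtain ⟨η, hη0, hη1, hη⟩ : ∃ η : ℝ, 0 < η ∧ η ≤ 1 ∧ -2 * η * Real.log t < ε / 4 := by
    have hc : Tendsto (fun η : ℝ => -2 * η * Real.log t) (𝓝[>] 0) (𝓝 (-2 * 0 * Real.log t)) :=
      (((continuous_const.mul continuous_id).mul continuous_const).tendsto _).mono_left
        nhdsWithin_le_nhds
    rw [mul_zero, zero_mul] at hc
    obtain ⟨t, h1, h2⟩ := ((hc.eventually_lt_const (by positivity : (0 : ℝ) < ε / 4)).and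
      (Ioc_mem_nhdsGT one_pos)).exists
    exact ⟨t, h2.1, h2.2, h1⟩
  obtain ⟨κ, hκ0, hκ1, hκ2⟩ : ∃ κ : ℝ, 0 < κ ∧ β * Real.sqrt (2 * q * κ / η) < ε / 4 ∧
      β / 2 * κ < ε / 4 := by
    have hc1 : Tendsto (fun κ : ℝ => β * Real.sqrt (2 * q * κ / η)) (𝓝[>] 0)
        (𝓝 (β * Real.sqrt (2 * q * 0 / η))) :=
      (Continuous.tendsto (by fun_prop) _).mono_left nhdsWithin_le_nhds
    have hc2 : Tendsto (fun κ : ℝ => β / 2 * κ) (𝓝[>] 0) (𝓝 (β / 2 * 0)) :=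
      (Continuous.tendsto (by fun_prop) _).mono_left nhdsWithin_le_nhds
    simp only [mul_zero, zero_div, Real.sqrt_zero] at hc1 hc2
    obtain ⟨t, ⟨h1, h2⟩, h3⟩ := (((hc1.eventually_lt_const (by positivity : (0 : ℝ) < ε / 4)).and
      (hc2.eventually_lt_const (by positivity : (0 : ℝ) < ε / 4))).and self_mem_nhdsWithin).exists
    exact ⟨t, h3, h1, h2⟩
  refine ⟨κ, hκ0, fun n hn A hA hA0 htr hrow => ?_⟩
  have hn' : (0 : ℝ) < n := Nat.cast_pos.2 hn
  have hup := logPartition_le hq A hA hA0 hβ h hκ0 hη0 hη1 ht0 ht1 htr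
  have hlow := curieWeissValue_le hq A hA0 hβ h
  have hrow' := mul_le_mul_of_nonneg_left hrow (div_nonneg hβ zero_le_two)
  set Φ := logPartition A (β • (1 : Matrix (Fin q) (Fin q) ℝ)) h
  have hΦ : (1 / (n : ℝ)) * Φ - curieWeissValue β h = (Φ - n * curieWeissValue β h) / n := by
    field_simp
  rw [hΦ, abs_div, Nat.abs_cast, div_lt_iff₀ hn', abs_lt]
  have e1 := mul_lt_mul_of_pos_right ht hn'
  have e2 := mul_lt_mul_of_pos_right hη hn'
  have e3 := mul_lt_mul_of_pos_right hκ1 hn'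
  have e4 := mul_lt_mul_of_pos_right hκ2 hn'
  have e5 := mul_pos hε hn'
  constructor <;> linarith

/-! ### From weak convergence to mean deviation of row sums. -/

theorem integral_empiricalMeasure {n : ℕ} (x : Fin n → ℝ) (f : BoundedContinuousFunction ℝ ℝ) :
    ∫ a, f a ∂(empiricalMeasure x : Measure ℝ) = (n : ℝ)⁻¹ * ∑ i, f (x i) := by
  have h1 : (empiricalMeasure x : Measure ℝ) = (n : ℝ≥0)⁻¹ • ∑ i, Measure.dirac (x i) := by
    rw [empiricalMeasure, FiniteMeasure.toMeasure_smul, FiniteMeasure.toMeasure_sum]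
    rfl
  rw [h1, integral_smul_nnreal_measure, integral_finsetSum_measure]
  · simp [NNReal.smul_def]
  · intro i _
    exact f.integrable _

/-- If the empirical measures of nonnegative arrays converge weakly to the point mass at `1` and
their means converge to `1`, then the mean absolute deviation from `1` tends to `0`. -/
theorem tendsto_mean_abs_sub_one (x : ∀ n : ℕ, Fin n → ℝ) (hx : ∀ n i, 0 ≤ x n i)
    (hw : Tendsto (fun n => empiricalMeasure (x n)) atTop
      (𝓝 (diracProba (1 : ℝ)).toFiniteMeasure))
    (hm : Tendsto (fun n : ℕ => (1 / (n : ℝ)) * ∑ i, x n i) atTop (𝓝 1)) :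
    Tendsto (fun n : ℕ => (n : ℝ)⁻¹ * ∑ i, |x n i - 1|) atTop (𝓝 0) := by
  -- The negative part of `a - 1`, cut off at `1` for boundedness; the cutoff is inactive for `a ≥
  -- 0`. Then `|a - 1| = (a - 1) + 2 f a`: the means control the first term and weak convergence the
  -- second.
  let f : BoundedContinuousFunction ℝ ℝ := BoundedContinuousFunction.ofNormedAddCommGroup
    (fun a => max 0 (min 1 (1 - a))) (by fun_prop) 1 (fun a => by
      rw [Real.norm_eq_abs, abs_of_nonneg (le_max_left _ _)]
      exact max_le zero_le_one (min_le_left _ _))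
  have hf : ∀ a, 0 ≤ a → |a - 1| = (a - 1) + 2 * f a := by
    intro a ha
    have : f a = max 0 (min 1 (1 - a)) := rfl
    rw [this, min_eq_right (by linarith)]
    rcases le_total a 1 with h | h
    · rw [max_eq_right (by linarith), abs_of_nonpos (by linarith)]
      ring
    · rw [max_eq_left (by linarith), abs_of_nonneg (by linarith)]
      ring
  have h1 := FiniteMeasure.tendsto_iff_forall_integral_tendsto.1 hw f
  have h2 : ∫ a, f a ∂((diracProba (1 : ℝ)).toFiniteMeasure : Measure ℝ) = 0 := by
    have : ((diracProba (1 : ℝ)).toFiniteMeasure : Measure ℝ) = Measure.dirac 1 := rfl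
    rw [this, integral_dirac]
    change max (0 : ℝ) (min 1 (1 - 1)) = 0
    norm_num
  simp_rw [integral_empiricalMeasure] at h1
  rw [h2] at h1
  have h3 := (hm.sub_const 1).add (h1.const_mul 2)
  rw [sub_self, mul_zero, add_zero] at h3
  refine h3.congr' ?_
  filter_upwards [eventually_gt_atTop 0] with n hn
  have hn' : (n : ℝ) ≠ 0 := by positivity
  simp_rw [fun i => hf _ (hx n i)]
  rw [Finset.sum_add_distrib, Finset.sum_sub_distrib, ← Finset.mul_sum]
  simp only [Finset.sum_const, Finset.card_univ, Fintype.card_fin, nsmul_eq_mul, mul_one]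
  field_simp

/-! ### Scaled adjacency matrices. -/

theorem scaledAdjMatrix_isSymm {n : ℕ} (c : ℝ) (G : SimpleGraph (Fin n)) :
    (scaledAdjMatrix c G).IsSymm := by
  classical
  ext i j
  simp only [scaledAdjMatrix, Matrix.transpose_apply, Matrix.of_apply]
  simp_rw [G.adj_comm j i]

theorem scaledAdjMatrix_nonneg {n : ℕ} {c : ℝ} (hc : 0 ≤ c) (G : SimpleGraph (Fin n))
    (i j : Fin n) : 0 ≤ scaledAdjMatrix c G i j := by
  simp only [scaledAdjMatrix, Matrix.of_apply]
  split_ifs <;> positivity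

/-- Entries are `0` or `1 / c`, so squaring one multiplies it by `1 / c`. For graphs, control of the
row sums and large `c` thus control the trace as well. -/
theorem trace_scaledAdjMatrix_mul_self {n : ℕ} (c : ℝ) (G : SimpleGraph (Fin n)) :
    (scaledAdjMatrix c G * scaledAdjMatrix c G).trace
      = 1 / c * ∑ i, rowSum (scaledAdjMatrix c G) i := by
  rw [trace_mul_self_eq_sum_sq _ (scaledAdjMatrix_isSymm c G), Finset.sum_comm, Finset.mul_sum]
  refine Finset.sum_congr rfl fun i _ => ?_
  rw [rowSum, Finset.mul_sum]
  refine Finset.sum_congr rfl fun j _ => ?_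
  simp only [scaledAdjMatrix, Matrix.of_apply]
  split_ifs <;> ring

theorem trace_scaledAdjMatrix_mul_self_le {n : ℕ} {c κ : ℝ} (hc : 0 < c) (hκ : 0 < κ)
    (hcκ : (1 + κ) / κ ≤ c) (G : SimpleGraph (Fin n))
    (hG : ∑ i, |rowSum (scaledAdjMatrix c G) i - 1| ≤ κ * n) :
    (scaledAdjMatrix c G * scaledAdjMatrix c G).trace ≤ κ * n := by
  have h1 : ∑ i, rowSum (scaledAdjMatrix c G) i ≤ (1 + κ) * n := by
    have : ∑ i, rowSum (scaledAdjMatrix c G) i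
        ≤ ∑ i : Fin n, (1 + |rowSum (scaledAdjMatrix c G) i - 1|) :=
      Finset.sum_le_sum fun i _ => by linarith [le_abs_self (rowSum (scaledAdjMatrix c G) i - 1)]
    rw [Finset.sum_add_distrib] at this
    simp only [Finset.sum_const, Finset.card_univ, Fintype.card_fin, nsmul_eq_mul] at this
    linarith
  rw [trace_scaledAdjMatrix_mul_self, one_div, inv_mul_le_iff₀ hc]
  rw [div_le_iff₀ hκ] at hcκ
  have := mul_le_mul_of_nonneg_right hcκ (Nat.cast_nonneg (α := ℝ) n)
  linarith

end Potts

/-! ### Degree moments in the binomial random graph. -/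

namespace SimpleGraph

/-- In the binomial random graph, all edges in `T` are present with probability `p ^ #T`. -/
theorem binomialRandom_subset_edgeSet {V : Type*} [Countable V] (p : unitInterval)
    (T : Finset (Sym2 V)) (hT : ∀ e ∈ T, ¬ e.IsDiag) :
    (binomialRandom V p).real {G | (T : Set (Sym2 V)) ⊆ G.edgeSet} = (p : ℝ) ^ T.card := by
  have hmeas : MeasurableSet {G : SimpleGraph V | (T : Set (Sym2 V)) ⊆ G.edgeSet} := by
    have : {G : SimpleGraph V | (T : Set (Sym2 V)) ⊆ G.edgeSet}
        = ⋂ e ∈ T, {G | e ∈ G.edgeSet} := by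
      ext G
      simp [Set.subset_def]
    rw [this]
    refine Finset.measurableSet_biInter _ fun e _ => ?_
    have h : Measurable fun G : SimpleGraph V => e ∈ G.edgeSet := by fun_prop
    exact h.setOf
  rw [measureReal_def, binomialRandom_eq_map, Measure.map_apply (by fun_prop) hmeas,
    ProbabilityTheory.setBernoulli_apply']
  -- `fromEdgeSet` discards only loops and `T` has none, so the event is a cylinder of the product
  -- measure.
  have h1 : ((fun P : Sym2 V → Prop => {e | P e}) ⁻¹'
      (fromEdgeSet ⁻¹' {G : SimpleGraph V | (T : Set (Sym2 V)) ⊆ G.edgeSet}))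
      = Set.pi T fun _ => {True} := by
    ext P
    simp only [Set.mem_preimage, Set.mem_ofPred_eq, edgeSet_fromEdgeSet, Set.mem_pi,
      Set.mem_singleton_iff, eq_iff_iff, iff_true]
    constructor
    · intro h e he
      exact (h he).1
    · intro h e he
      exact ⟨h e he, by simpa using hT e he⟩
  rw [h1, Measure.infinitePi_pi _ (fun _ _ => measurableSet_singleton _)]
  have h2 : ∀ e ∈ T, (unitInterval.toNNReal p • Measure.dirac (e ∈ (Sym2.diagSet : Set (Sym2 V))ᶜ)
      + unitInterval.toNNReal (unitInterval.symm p) • Measure.dirac False) {True}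
      = (unitInterval.toNNReal p : ℝ≥0∞) := by
    intro e he
    have : e ∈ (Sym2.diagSet : Set (Sym2 V))ᶜ := by simpa using hT e he
    simp [this]
  rw [Finset.prod_congr rfl h2]
  simp

instance instMeasurableSingletonClass {V : Type*} [Countable V] :
    MeasurableSingletonClass (SimpleGraph V) where
  measurableSet_singleton G := by
    have h : ({G} : Set (SimpleGraph V)) = ⋂ u, ⋂ v, {H | H.Adj u v ↔ G.Adj u v} := by
      ext H
      simp [SimpleGraph.ext_iff, funext_iff]
    rw [h]
    refine MeasurableSet.iInter fun u => MeasurableSet.iInter fun v => ?_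
    have h : Measurable fun H : SimpleGraph V => (H.Adj u v ↔ G.Adj u v) := by fun_prop
    exact h.setOf

open scoped Classical in
theorem integral_adj_binomialRandom {n : ℕ} (p : unitInterval) {i j : Fin n} (hij : i ≠ j) :
    ∫ G, (if G.Adj i j then (1 : ℝ) else 0) ∂binomialRandom (Fin n) p = p := by
  have h := binomialRandom_subset_edgeSet p {s(i, j)} (by simpa using hij)
  simp only [Finset.coe_singleton, Set.singleton_subset_iff, mem_edgeSet, Finset.card_singleton,
    pow_one] at h
  rw [← h, ← integral_indicator_one (Set.toFinite _).measurableSet]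
  rfl

open scoped Classical in
theorem integral_adj_mul_adj_binomialRandom {n : ℕ} (p : unitInterval) {i j k : Fin n}
    (hij : i ≠ j) (hik : i ≠ k) (hjk : j ≠ k) :
    ∫ G, (if G.Adj i j then (1 : ℝ) else 0) * (if G.Adj i k then 1 else 0)
      ∂binomialRandom (Fin n) p = p ^ 2 := by
  have hne : s(i, j) ≠ s(i, k) := by
    rw [Ne, Sym2.congr_right]
    exact hjk
  have h := binomialRandom_subset_edgeSet p {s(i, j), s(i, k)} (by simp [hij, hik])
  rw [Finset.card_pair hne] at h
  rw [← h, ← integral_indicator_one (Set.toFinite _).measurableSet]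
  refine integral_congr_ae (Eventually.of_forall fun G => ?_)
  simp only [Set.indicator_apply, Set.mem_ofPred_eq, Finset.coe_pair, Set.insert_subset_iff,
    Set.singleton_subset_iff, mem_edgeSet, Pi.one_apply]
  split_ifs <;> simp_all

open scoped Classical in
/-- The second moment of the deviation of a degree from `n p` in the binomial random graph. -/
theorem integral_sq_degree_sub_le {n : ℕ} (p : unitInterval) (i : Fin n) :
    ∫ G, (∑ j, (if G.Adj i j then (1 : ℝ) else 0) - n * p) ^ 2 ∂binomialRandom (Fin n) p
      ≤ n * p := by
  set μ := binomialRandom (Fin n) p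
  set X : Fin n → SimpleGraph (Fin n) → ℝ := fun j G => if G.Adj i j then 1 else 0 with hX
  have hint : ∀ f : SimpleGraph (Fin n) → ℝ, Integrable f μ := fun f => Integrable.of_finite
  have h1 : ∀ j, i ≠ j → ∫ G, X j G ∂μ = p := fun j hj => integral_adj_binomialRandom p hj
  -- Distinct edges at `i` are uncorrelated, so only the diagonal of the double sum survives.
  have hcov : ∀ j k, i ≠ j → i ≠ k → ∫ G, (X j G - p) * (X k G - p) ∂μ
      = if j = k then (p : ℝ) * (1 - p) else 0 := by
    intro j k hj hk
    have h2 : ∀ G, (X j G - p) * (X k G - p) = X j G * X k G - p * X j G - p * X k G + p ^ 2 :=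
      fun G => by ring
    simp_rw [h2]
    rw [integral_add (hint _) (hint _), integral_sub (hint _) (hint _),
      integral_sub (hint _) (hint _), integral_const_mul, integral_const_mul, h1 j hj, h1 k hk]
    simp only [integral_const, probReal_univ, one_smul]
    split_ifs with hjk
    · subst hjk
      have h3 : ∀ G, X j G * X j G = X j G := fun G => by simp [hX]
      simp_rw [h3, h1 j hj]
      ring
    · rw [integral_adj_mul_adj_binomialRandom p hj hk hjk]
      ring
  set s := Finset.univ.erase i with hs
  have hsi : ∀ j ∈ s, i ≠ j := fun j hj => (Finset.ne_of_mem_erase hj).symm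
  have hn : 1 ≤ n := i.pos
  have hcard : (s.card : ℝ) = n - 1 := by
    rw [hs, Finset.card_erase_of_mem (Finset.mem_univ i), Finset.card_univ, Fintype.card_fin,
      Nat.cast_sub hn, Nat.cast_one]
  -- The degree has only `n - 1` random terms, so centering at `n p` is off by `p`; this yields the
  -- linear term, of mean zero, and `p ^ 2`.
  have hY : ∀ G, (∑ j, X j G - n * p) ^ 2
      = ∑ j ∈ s, ∑ k ∈ s, (X j G - p) * (X k G - p) - 2 * p * ∑ j ∈ s, (X j G - p) + p ^ 2 := by
    intro G
    have h2 : ∑ j, X j G = ∑ j ∈ s, (X j G - p) + (n - 1) * p := by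
      rw [Finset.sum_sub_distrib, Finset.sum_const, nsmul_eq_mul, hcard,
        ← Finset.add_sum_erase _ _ (Finset.mem_univ i)]
      simp [hX, hs]
    rw [h2, ← Finset.sum_mul_sum]
    ring
  have hp0 : (0 : ℝ) ≤ p := p.2.1
  have hp1 : (p : ℝ) ≤ 1 := p.2.2
  calc ∫ G, (∑ j, X j G - n * p) ^ 2 ∂μ
      = ∑ j ∈ s, ∑ k ∈ s, (if j = k then (p : ℝ) * (1 - p) else 0)
          - 2 * p * ∑ j ∈ s, ((p : ℝ) - p) + p ^ 2 := by
        simp_rw [hY]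
        rw [integral_add (hint _) (hint _), integral_sub (hint _) (hint _), integral_const_mul,
          integral_finsetSum _ fun _ _ => hint _, integral_finsetSum _ fun _ _ => hint _]
        congr 1
        · congr 1
          · refine Finset.sum_congr rfl fun j hj => ?_
            rw [integral_finsetSum _ fun _ _ => hint _]
            exact Finset.sum_congr rfl fun k hk => hcov j k (hsi j hj) (hsi k hk)
          · congr 1
            refine Finset.sum_congr rfl fun j hj => ?_
            rw [integral_sub (hint _) (hint _), h1 j (hsi j hj)]
            simp
        · simp
    _ = (n - 1) * (p * (1 - p)) + p ^ 2 := by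
        simp [hcard]
    _ ≤ n * p := by
        have : (1 : ℝ) ≤ n := Nat.one_le_cast.2 hn
        nlinarith [mul_nonneg (sub_nonneg.2 this) (sq_nonneg (p : ℝ)),
          mul_nonneg hp0 (sub_nonneg.2 hp1)]

end SimpleGraph

namespace Potts

open scoped Classical in
/-- Chebyshev's inequality for the row sums of the scaled adjacency matrix of the binomial random
graph. -/
theorem binomialRandom_sum_abs_rowSum_sub_one_gt {n : ℕ} (hn : 0 < n) (p : unitInterval)
    (hp : 0 < (n : ℝ) * p) {κ : ℝ} (hκ : 0 < κ) :
    SimpleGraph.binomialRandom (Fin n) p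
        {G | κ * n < ∑ i, |rowSum (scaledAdjMatrix (n * p) G) i - 1|}
      ≤ ENNReal.ofReal (1 / (κ ^ 2 * (n * p))) := by
  set μ := SimpleGraph.binomialRandom (Fin n) p
  have hn' : (0 : ℝ) < n := Nat.cast_pos.2 hn
  set c : ℝ := n * p with hc
  have hint : ∀ f : SimpleGraph (Fin n) → ℝ, Integrable f μ := fun f => Integrable.of_finite
  -- Markov's inequality is applied to this sum of squares, of mean at most `n / c`; Cauchy–Schwarz
  -- shows that an `ℓ¹` deviation above `κ n` forces `f ≥ κ² n`.
  set f : SimpleGraph (Fin n) → ℝ := fun G => ∑ i, (rowSum (scaledAdjMatrix c G) i - 1) ^ 2 with hf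
  have hrow : ∀ G : SimpleGraph (Fin n), ∀ i, (rowSum (scaledAdjMatrix c G) i - 1) ^ 2
      = (1 / c) ^ 2 * (∑ j, (if G.Adj i j then (1 : ℝ) else 0) - n * p) ^ 2 := by
    intro G i
    have h1 : rowSum (scaledAdjMatrix c G) i = 1 / c * ∑ j, if G.Adj i j then (1 : ℝ) else 0 := by
      simp only [rowSum, scaledAdjMatrix, Matrix.of_apply]
      rw [Finset.mul_sum]
      refine Finset.sum_congr rfl fun j _ => ?_
      split_ifs <;> simp
    rw [h1, ← mul_pow, ← hc]
    congr 1
    field_simp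
  have hmean : ∫ G, f G ∂μ ≤ n / c := by
    simp_rw [hf]
    rw [integral_finsetSum _ fun _ _ => hint _]
    calc ∑ i, ∫ G, (rowSum (scaledAdjMatrix c G) i - 1) ^ 2 ∂μ
        ≤ ∑ _i : Fin n, (1 / c) ^ 2 * c := by
          refine Finset.sum_le_sum fun i _ => ?_
          simp_rw [hrow]
          rw [integral_const_mul]
          exact mul_le_mul_of_nonneg_left (SimpleGraph.integral_sq_degree_sub_le p i) (sq_nonneg _)
      _ = n / c := by
          simp only [Finset.sum_const, Finset.card_univ, Fintype.card_fin, nsmul_eq_mul]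
          field_simp
  have hmarkov := mul_meas_ge_le_integral_of_nonneg (μ := μ) (f := f)
    (Eventually.of_forall fun G => Finset.sum_nonneg fun i _ => sq_nonneg _) (hint f) (κ ^ 2 * n)
  have hsub : {G | κ * n < ∑ i, |rowSum (scaledAdjMatrix c G) i - 1|} ⊆ {G | κ ^ 2 * n ≤ f G} := by
    intro G hG
    simp only [Set.mem_ofPred_eq] at hG ⊢
    have hcs := sq_sum_le_card_mul_sum_sq (s := (Finset.univ : Finset (Fin n)))
      (f := fun i => |rowSum (scaledAdjMatrix c G) i - 1|)
    simp only [Finset.card_univ, Fintype.card_fin, sq_abs] at hcs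
    have h1 : (κ * n) ^ 2 ≤ (∑ i, |rowSum (scaledAdjMatrix c G) i - 1|) ^ 2 :=
      pow_le_pow_left₀ (by positivity) hG.le 2
    have h2 : n * (κ ^ 2 * n) ≤ n * f G := by
      calc n * (κ ^ 2 * n) = (κ * n) ^ 2 := by ring
        _ ≤ _ := h1.trans hcs
    exact le_of_mul_le_mul_left h2 hn'
  refine (measure_mono hsub).trans ?_
  rw [← ENNReal.ofReal_toReal (measure_ne_top μ {G | κ ^ 2 * n ≤ f G})]
  refine ENNReal.ofReal_le_ofReal ?_
  rw [le_div_iff₀ (by positivity)]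
  have h3 : κ ^ 2 * n * μ.real {G | κ ^ 2 * n ≤ f G} ≤ n / c := hmarkov.trans hmean
  rw [le_div_iff₀ hp] at h3
  have h4 : n * (μ.real {G | κ ^ 2 * n ≤ f G} * (κ ^ 2 * c)) ≤ n * 1 := by linarith
  exact le_of_mul_le_mul_left h4 hn'

end Potts

/-! ### Reduction of the three cases to the deterministic estimate. -/

theorem mainTheorem2 (q : ℕ) (hq : 2 ≤ q) (β : ℝ) (hβ : 0 ≤ β) (h : Fin q → ℝ) :
    -- part (a): asymptotically regular nonnegative matrices
    (∀ A : ∀ n : ℕ, Matrix (Fin n) (Fin n) ℝ,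
      Potts.MeanFieldAssumption A →
      (∀ n i j, 0 ≤ A n i j) →
      Tendsto (fun n => Potts.empiricalMeasure (Potts.rowSum (A n))) atTop
        (𝓝 (diracProba (1 : ℝ)).toFiniteMeasure) →
      Tendsto (fun n : ℕ => (1 / (n : ℝ)) * ∑ i, Potts.rowSum (A n) i) atTop (𝓝 1) →
      Tendsto (fun n : ℕ =>
          (1 / (n : ℝ)) * Potts.logPartition (A n) (β • (1 : Matrix (Fin q) (Fin q) ℝ)) h)
        atTop (𝓝 (Potts.curieWeissValue β h))) ∧
    -- part (b)(i): regular graphs of diverging degree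
    (∀ (d : ℕ → ℕ) (G : ∀ n : ℕ, SimpleGraph (Fin n)) [∀ n, (G n).LocallyFinite],
      (∀ n, (G n).IsRegularOfDegree (d n)) →
      Tendsto d atTop atTop →
      Tendsto (fun n : ℕ =>
          (1 / (n : ℝ)) * Potts.logPartition (Potts.scaledAdjMatrix (d n) (G n))
            (β • (1 : Matrix (Fin q) (Fin q) ℝ)) h)
        atTop (𝓝 (Potts.curieWeissValue β h))) ∧
    -- part (b)(ii): Erdős–Rényi graphs, convergence in probability
    (∀ p : ℕ → unitInterval,
      Tendsto (fun n : ℕ => (n : ℝ) * (p n : ℝ)) atTop atTop →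
      ∀ ε : ℝ, 0 < ε →
        Tendsto (fun n : ℕ => SimpleGraph.binomialRandom (Fin n) (p n)
            {G | ε ≤ |(1 / (n : ℝ)) * Potts.logPartition
                (Potts.scaledAdjMatrix ((n : ℝ) * (p n : ℝ)) G)
                (β • (1 : Matrix (Fin q) (Fin q) ℝ)) h - Potts.curieWeissValue β h|})
          atTop (𝓝 0)) := by
  have hq0 : 0 < q := by omega
  refine ⟨?_, ?_, ?_⟩
  · intro A hA hA0 hweak hmean
    rw [Metric.tendsto_nhds]
    intro ε hε
    obtain ⟨κ, hκ, hcore⟩ := Potts.exists_abs_logPartition_sub_lt hq0 hβ h hε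
    have hrow := Potts.tendsto_mean_abs_sub_one (fun n => Potts.rowSum (A n))
      (fun n i => Finset.sum_nonneg fun j _ => hA0 n i j) hweak hmean
    filter_upwards [eventually_gt_atTop 0, hrow.eventually_lt_const hκ,
      hA.trace_sq_isLittleO.bound hκ] with n hn h1 h2
    have hn' : (0 : ℝ) < n := Nat.cast_pos.2 hn
    rw [Real.dist_eq]
    refine hcore n hn (A n) (hA.symm n) (hA0 n) ?_ ?_
    · rw [Real.norm_eq_abs, Real.norm_eq_abs, Nat.abs_cast] at h2
      exact (le_abs_self _).trans h2
    · rw [inv_mul_lt_iff₀ hn'] at h1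
      linarith
  · intro d G _ hreg hd
    rw [Metric.tendsto_nhds]
    intro ε hε
    obtain ⟨κ, hκ, hcore⟩ := Potts.exists_abs_logPartition_sub_lt hq0 hβ h hε
    filter_upwards [eventually_gt_atTop 0, hd.eventually_gt_atTop 0,
      (tendsto_natCast_atTop_atTop (R := ℝ)).comp hd |>.eventually_ge_atTop ((1 + κ) / κ)]
      with n hn hd0 hdκ
    have hd' : (0 : ℝ) < d n := Nat.cast_pos.2 hd0
    have hrow : ∑ i, |Potts.rowSum (Potts.scaledAdjMatrix (d n) (G n)) i - 1| ≤ κ * n := by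
      have h1 : ∀ i, Potts.rowSum (Potts.scaledAdjMatrix (d n) (G n)) i = 1 := by
        classical
        intro i
        have h2 : ((Finset.univ.filter fun j => (G n).Adj i j).card) = d n := by
          rw [← hreg n i, ← SimpleGraph.card_neighborFinset_eq_degree]
          congr 1
          ext j
          simp
        simp only [Potts.rowSum, Potts.scaledAdjMatrix, Matrix.of_apply]
        rw [← Finset.sum_filter, Finset.sum_const, nsmul_eq_mul]
        refine Eq.trans ?_ (mul_one_div_cancel hd'.ne')
        congr 2
      simp only [h1, sub_self, abs_zero, Finset.sum_const_zero]
      positivity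
    rw [Real.dist_eq]
    exact hcore n hn _ (Potts.scaledAdjMatrix_isSymm _ _)
      (Potts.scaledAdjMatrix_nonneg hd'.le _)
      (Potts.trace_scaledAdjMatrix_mul_self_le hd' hκ hdκ _ hrow) hrow
  · intro p hp ε hε
    obtain ⟨κ, hκ, hcore⟩ := Potts.exists_abs_logPartition_sub_lt hq0 hβ h hε
    have hlim : Tendsto (fun n : ℕ => ENNReal.ofReal (1 / (κ ^ 2 * (n * (p n : ℝ))))) atTop
        (𝓝 0) := by
      rw [← ENNReal.ofReal_zero]
      refine ENNReal.tendsto_ofReal ?_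
      simp_rw [one_div]
      exact (hp.const_mul_atTop (by positivity)).inv_tendsto_atTop
    refine tendsto_of_tendsto_of_tendsto_of_le_of_le' tendsto_const_nhds hlim
      (Eventually.of_forall fun _ => zero_le) ?_
    filter_upwards [eventually_gt_atTop 0, hp.eventually_gt_atTop 0,
      hp.eventually_ge_atTop ((1 + κ) / κ)] with n hn hp0 hpκ
    -- By the deterministic estimate, a deviation of at least `ε` forces the row sums to be bad,
    -- since the trace bound follows from good row sums.
    refine le_trans (measure_mono fun G hG => ?_)
      (Potts.binomialRandom_sum_abs_rowSum_sub_one_gt hn (p n) hp0 hκ)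
    simp only [Set.mem_ofPred_eq] at hG ⊢
    by_contra! hrow
    exact absurd (hcore n hn _ (Potts.scaledAdjMatrix_isSymm _ _)
      (Potts.scaledAdjMatrix_nonneg hp0.le G)
      (Potts.trace_scaledAdjMatrix_mul_self_le hp0 hκ hpκ G hrow) hrow) hG.not_gt
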